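/- Let $\Omega\subset\mathbb R^d$, $d\in\{2,3\}$, be an open bounded convex polygonal or polyhedral domain with outward unit normal $\boldsymbol n$; let $(\cdot,\cdot)$ and $\|\cdot\|$ be the (scalar or vector) $L^2(\Omega)$ inner product and norm. Let $M,\lambda,\nu,\epsilon,\beta,\delta_0,\theta,T>0$, let $N_t\ge 1$ be an integer and $\tau=T/N_t$. Put $G(s)=\frac{1}{4\epsilon^2}(1-s^2)^2$, $F(s)=G(s)-\frac{\beta}{2}s^2$, $E_1(\phi)=\int_\Omega F(\phi)\,dx$, $\boldsymbol b(\boldsymbol u,\boldsymbol v,\boldsymbol w)=(\boldsymbol u\cdot\nabla\boldsymbol v,\boldsymbol w)$. Consider the first-order incremental viscosity splitting (IVS) scheme: from data $\phi^0,\mu^0,p^0\in H^1(\Omega)$, $\boldsymbol u^0\in \mathbf H^1_0(\Omega)$, $R^0\in\mathbb R$, the iterates satisfy, for $0\le n\le N_t-1$, with $$\gamma^n=\frac{\theta}{\|\nabla p^n\|+1},\qquad \rho^n=\sqrt{E_1(\phi^n)+\delta_0},\qquad \xi^{n+1}=\frac{R^{n+1}}{\rho^n},$$ almost everywhere in $\Omega$,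 $$\tfrac{\phi^{n+1}-\phi^n}{\tau}+\xi^{n+1}\nabla\cdot(\boldsymbol u^n\phi^n)=M\Delta\mu^{n+1},\qquad \mu^{n+1}=-\lambda\Delta\phi^{n+1}+\lambda\beta\phi^{n+1}+\lambda\xi^{n+1}F'(\phi^n),$$ $$\tfrac{\widehat{\boldsymbol u}^{n+1}-\boldsymbol u^n}{\tau}+\xi^{n+1}\boldsymbol u^n\cdot\nabla\boldsymbol u^n-\nu\Delta\widehat{\boldsymbol u}^{n+1}=-\xi^{n+1}\big(\phi^n\nabla\mu^n+\gamma^n\nabla p^n\big),$$ $$\tfrac{R^{n+1}-R^n}{\tau}=\tfrac{1}{2\lambda\rho^n}\Big(\lambda\big(F'(\phi^n),\tfrac{\phi^{n+1}-\phi^n}{\tau}\big)+(\mu^{n+1},\nabla\cdot(\boldsymbol u^n\phi^n))+(\widehat{\boldsymbol u}^{n+1},\phi^n\nabla\mu^n)+\boldsymbol b(\boldsymbol u^n,\boldsymbol u^n,\widehat{\boldsymbol u}^{n+1})+\gamma^n(\nabla p^n,\widehat{\boldsymbol u}^{n+1})\Big),$$ $$\tfrac{\boldsymbol u^{n+1}-\widehat{\boldsymbol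 u}^{n+1}}{\tau}-\nu\Delta(\boldsymbol u^{n+1}-\widehat{\boldsymbol u}^{n+1})+\nabla p^{n+1}=\gamma^n\nabla p^n,\qquad \nabla\cdot\boldsymbol u^{n+1}=0,$$ with the boundary conditions $\partial_{\boldsymbol n}\phi^{n+1}=\partial_{\boldsymbol n}\mu^{n+1}=0$ and $\widehat{\boldsymbol u}^{n+1}=\boldsymbol u^{n+1}=\boldsymbol 0$ on $\partial\Omega$. Here $\phi^{n+1},\mu^{n+1},p^{n+1}\in H^1(\Omega)$, $\widehat{\boldsymbol u}^{n+1},\boldsymbol u^{n+1}\in\mathbf H^1_0(\Omega)$, the weak Laplacians of $\phi^{n+1},\mu^{n+1},\widehat{\boldsymbol u}^{n+1},\boldsymbol u^{n+1}$ lie in $L^2(\Omega)$, and $\partial_{\boldsymbol n}f=0$ means that the normal trace of $\nabla f$ in $H^{-1/2}(\partial\Omega)$ vanishes, i.e. $(\nabla f,\nabla v)+(\Delta f,v)=0$ for all $v\in H^1(\Omega)$. Assume $E_1(\phi^n)+\delta_0>0$ for $0\le n\le N_t-1$. Then every such solution conserves mass, $$(\phi^{n+1},1)=(\phi^n,1),\qquad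 0\le n\le N_t-1,$$ and, without any restriction on $\tau$, satisfies the modified energy dissipation law $$E^{n+1}-E^n\le -M\tau\|\nabla\mu^{n+1}\|^2-\frac{\nu\tau}{2}\big(\|\nabla\widehat{\boldsymbol u}^{n+1}\|^2+\|\nabla\boldsymbol u^{n+1}\|^2\big),\qquad 0\le n\le N_t-1,$$ where $E^{n}=\frac12\|\boldsymbol u^{n}\|^2+\frac{\lambda}{2}\|\nabla\phi^{n}\|^2+\frac{\lambda\beta}{2}\|\phi^{n}\|^2+\lambda|R^{n}|^2$. -/

import Mathlib

open MeasureTheory Filter Topology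
open scoped ContDiff

namespace CHNS

noncomputable section

/-- The Euclidean space of dimension `d`. -/
abbrev Vec (d : ℕ) := EuclideanSpace ℝ (Fin d)

/-! ### Domain, test functions, weak derivatives -/

/-- An open bounded convex polygonal (`d = 2`) or polyhedral (`d = 3`) domain: the non-empty
interior of the convex hull of finitely many points. -/
def IsConvexPolytopeDomain {d : ℕ} (Ω : Set (Vec d)) : Prop :=
  Ω.Nonempty ∧ ∃ V : Finset (Vec d), Ω = interior (convexHull ℝ (V : Set (Vec d)))

/-- Test functions on `Ω`: smooth, with compact support contained in `Ω`. -/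
def IsTest {d : ℕ} (Ω : Set (Vec d)) (η : Vec d → ℝ) : Prop :=
  ContDiff ℝ ∞ η ∧ HasCompactSupport η ∧ tsupport η ⊆ Ω

/-- `g` is the weak gradient of the scalar function `f` on `Ω`. -/
def IsWeakGrad {d : ℕ} (Ω : Set (Vec d)) (f : Vec d → ℝ) (g : Vec d → Vec d) : Prop :=
  LocallyIntegrableOn f Ω ∧ LocallyIntegrableOn g Ω ∧
    ∀ η : Vec d → ℝ, IsTest Ω η →
      ∫ x in Ω, f x • gradient η x = - ∫ x in Ω, η x • g x

/-- `w` is the weak divergence of the vector field `q` on `Ω`. -/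
def IsWeakDiv {d : ℕ} (Ω : Set (Vec d)) (q : Vec d → Vec d) (w : Vec d → ℝ) : Prop :=
  LocallyIntegrableOn q Ω ∧ LocallyIntegrableOn w Ω ∧
    ∀ η : Vec d → ℝ, IsTest Ω η →
      ∫ x in Ω, inner ℝ (q x) (gradient η x) = - ∫ x in Ω, η x * w x

open Classical in
/-- The weak gradient `∇ f` on `Ω` (a representative; `0` if there is none). -/
def weakGrad {d : ℕ} (Ω : Set (Vec d)) (f : Vec d → ℝ) : Vec d → Vec d :=
  if h : ∃ g, IsWeakGrad Ω f g then h.choose else 0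

open Classical in
/-- The weak divergence `∇ · q` on `Ω` (a representative; `0` if there is none). -/
def weakDiv {d : ℕ} (Ω : Set (Vec d)) (q : Vec d → Vec d) : Vec d → ℝ :=
  if h : ∃ w, IsWeakDiv Ω q w then h.choose else 0

/-- The weak Laplacian `Δ f = ∇ · ∇ f` on `Ω`. -/
def weakLap {d : ℕ} (Ω : Set (Vec d)) (f : Vec d → ℝ) : Vec d → ℝ :=
  weakDiv Ω (weakGrad Ω f)

/-- The `i`-th component of a vector field. -/
def comp {d : ℕ} (v : Vec d → Vec d) (i : Fin d) : Vec d → ℝ := fun x => v x i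

/-- The convective derivative `u · ∇ v`, with components `u · ∇ v_i`. -/
def convect {d : ℕ} (Ω : Set (Vec d)) (u v : Vec d → Vec d) : Vec d → Vec d :=
  fun x => WithLp.toLp 2 (fun i => inner ℝ (u x) (weakGrad Ω (comp v i) x))

/-- The componentwise weak Laplacian of a vector field. -/
def vecLap {d : ℕ} (Ω : Set (Vec d)) (v : Vec d → Vec d) : Vec d → Vec d :=
  fun x => WithLp.toLp 2 (fun i => weakLap Ω (comp v i) x)

/-! ### Function spaces and boundary conditions -/

/-- Membership in `L²(Ω)`. -/
def MemL2 {d : ℕ} {F : Type*} [NormedAddCommGroup F] (Ω : Set (Vec d)) (f : Vec d → F) : Prop :=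
  MemLp f 2 (volume.restrict Ω)

/-- Membership in the Sobolev space `H¹(Ω)`. -/
def MemH1 {d : ℕ} (Ω : Set (Vec d)) (f : Vec d → ℝ) : Prop :=
  MemL2 Ω f ∧ ∃ g, IsWeakGrad Ω f g ∧ MemL2 Ω g

/-- Membership in `H¹₀(Ω)` (zero boundary values): the closure of the test functions in `H¹(Ω)`. -/
def MemH10 {d : ℕ} (Ω : Set (Vec d)) (f : Vec d → ℝ) : Prop :=
  MemL2 Ω f ∧ ∃ g, IsWeakGrad Ω f g ∧ MemL2 Ω g ∧
    ∃ η : ℕ → Vec d → ℝ, (∀ k, IsTest Ω (η k)) ∧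
      Tendsto (fun k => eLpNorm (fun x => η k x - f x) 2 (volume.restrict Ω)) atTop (𝓝 0) ∧
      Tendsto (fun k => eLpNorm (fun x => gradient (η k) x - g x) 2 (volume.restrict Ω))
        atTop (𝓝 0)

/-- Vector fields with components in `H¹₀(Ω)`. -/
def VecMemH10 {d : ℕ} (Ω : Set (Vec d)) (v : Vec d → Vec d) : Prop :=
  ∀ i, MemH10 Ω (comp v i)

/-- The weak Laplacian of `f` exists and lies in `L²(Ω)`. -/
def HasL2Lap {d : ℕ} (Ω : Set (Vec d)) (f : Vec d → ℝ) : Prop :=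
  ∃ w, IsWeakDiv Ω (weakGrad Ω f) w ∧ MemL2 Ω w

/-- Vector fields whose weak Laplacian exists and lies in `L²(Ω)`. -/
def VecHasL2Lap {d : ℕ} (Ω : Set (Vec d)) (v : Vec d → Vec d) : Prop :=
  ∀ i, HasL2Lap Ω (comp v i)

/-- The boundary condition `∂ₙ f = 0` on `∂Ω`, for `f ∈ H¹(Ω)` with `Δ f ∈ L²(Ω)`: the normal trace
in `H^{-1/2}(∂Ω)` of the `H(div)` field `∇ f`, which is the functional
`v ↦ (∇ f, ∇ v) + (Δ f, v)` on `H¹(Ω)`, vanishes. -/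
def ZeroNormalDeriv {d : ℕ} (Ω : Set (Vec d)) (f : Vec d → ℝ) : Prop :=
  ∀ v : Vec d → ℝ, MemH1 Ω v →
    (∫ x in Ω, inner ℝ (weakGrad Ω f x) (weakGrad Ω v x)) + ∫ x in Ω, weakLap Ω f x * v x = 0

/-! ### Inner products and norms -/

/-- The (scalar or vector) `L²(Ω)` inner product `(f, g)`. -/
def ip {d : ℕ} {F : Type*} [NormedAddCommGroup F] [InnerProductSpace ℝ F]
    (Ω : Set (Vec d)) (f g : Vec d → F) : ℝ :=
  ∫ x in Ω, inner ℝ (f x) (g x)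

/-- The squared (scalar or vector) `L²(Ω)` norm `‖f‖²`. -/
def sqNorm {d : ℕ} {F : Type*} [NormedAddCommGroup F] (Ω : Set (Vec d)) (f : Vec d → F) : ℝ :=
  ∫ x in Ω, ‖f x‖ ^ 2

/-- The squared norm `‖∇ v‖²` of the gradient of a vector field. -/
def vecGradSqNorm {d : ℕ} (Ω : Set (Vec d)) (v : Vec d → Vec d) : ℝ :=
  ∑ i, sqNorm Ω (weakGrad Ω (comp v i))

/-- The trilinear form `b(u, v, w) = (u · ∇ v, w)`. -/
def trilinear {d : ℕ} (Ω : Set (Vec d)) (u v w : Vec d → Vec d) : ℝ :=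
  ip Ω (convect Ω u v) w

/-! ### The scheme -/

/-- The physical and numerical parameters: mobility `M`, mixing coefficient `lam`, viscosity `ν`,
interfacial width `ε`, splitting constant `β`, shift `δ₀`, pressure parameter `θ`, final time `T`
and number `N` of time steps. -/
structure Params where
  M : ℝ
  lam : ℝ
  ν : ℝ
  ε : ℝ
  β : ℝ
  δ₀ : ℝ
  θ : ℝ
  T : ℝ
  N : ℕ
  M_pos : 0 < M
  lam_pos : 0 < lam
  ν_pos : 0 < ν
  ε_pos : 0 < ε
  β_pos : 0 < β
  δ₀_pos : 0 < δ₀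
  θ_pos : 0 < θ
  T_pos : 0 < T
  N_pos : 0 < N

/-- The time step `τ = T / N`. -/
def Params.τ (P : Params) : ℝ := P.T / P.N

/-- The Ginzburg–Landau potential `G(s) = (1 - s²)² / (4 ε²)`. -/
def Params.G (P : Params) (s : ℝ) : ℝ := 1 / (4 * P.ε ^ 2) * (1 - s ^ 2) ^ 2

/-- `F(s) = G(s) - β s² / 2`. -/
def Params.F (P : Params) (s : ℝ) : ℝ := P.G s - P.β / 2 * s ^ 2

/-- `F'(φ)`. -/
def Params.dF {d : ℕ} (P : Params) (φ : Vec d → ℝ) : Vec d → ℝ := fun x => deriv P.F (φ x)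

/-- `E₁(φ) = ∫_Ω F(φ)`. -/
def Params.E₁ {d : ℕ} (P : Params) (Ω : Set (Vec d)) (φ : Vec d → ℝ) : ℝ := ∫ x in Ω, P.F (φ x)

/-- `√(E₁(φ) + δ₀)`. -/
def Params.rootE {d : ℕ} (P : Params) (Ω : Set (Vec d)) (φ : Vec d → ℝ) : ℝ :=
  √(P.E₁ Ω φ + P.δ₀)

/-- `γ = θ / (‖∇ p‖ + 1)`. -/
def Params.γ {d : ℕ} (P : Params) (Ω : Set (Vec d)) (p : Vec d → ℝ) : ℝ :=
  P.θ / (√(sqNorm Ω (weakGrad Ω p)) + 1)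

/-- The modified energy
`E(φ, u, R) = ½ ‖u‖² + (lam / 2) ‖∇ φ‖² + (lam β / 2) ‖φ‖² + lam |R|²`. -/
def Params.energy {d : ℕ} (P : Params) (Ω : Set (Vec d)) (φ : Vec d → ℝ) (u : Vec d → Vec d)
    (R : ℝ) : ℝ :=
  1 / 2 * sqNorm Ω u + P.lam / 2 * sqNorm Ω (weakGrad Ω φ) + P.lam * P.β / 2 * sqNorm Ω φ
    + P.lam * |R| ^ 2

/-- One time step of the first-order scheme, from `(φ, μ, u, p, R)` at time `t_n` to
`(φ', μ', û', u', p', R')` at time `t_{n+1}`. Equations hold almost everywhere in `Ω`. -/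
structure IVSStep {d : ℕ} (P : Params) (Ω : Set (Vec d))
    (φ μ : Vec d → ℝ) (u : Vec d → Vec d) (p : Vec d → ℝ) (R : ℝ)
    (φ' μ' : Vec d → ℝ) (uhat' u' : Vec d → Vec d) (p' : Vec d → ℝ) (R' : ℝ) : Prop where
  φ_H1 : MemH1 Ω φ'
  φ_lap : HasL2Lap Ω φ'
  φ_bdry : ZeroNormalDeriv Ω φ'
  μ_H1 : MemH1 Ω μ'
  μ_lap : HasL2Lap Ω μ'
  μ_bdry : ZeroNormalDeriv Ω μ'
  uhat_H10 : VecMemH10 Ω uhat'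
  uhat_lap : VecHasL2Lap Ω uhat'
  u_H10 : VecMemH10 Ω u'
  u_lap : VecHasL2Lap Ω u'
  p_H1 : MemH1 Ω p'
  /-- Step 1: the phase-field equation. -/
  phase : ∀ᵐ x ∂(volume.restrict Ω),
    (φ' x - φ x) / P.τ + R' / P.rootE Ω φ * weakDiv Ω (fun y => φ y • u y) x
      = P.M * weakLap Ω μ' x
  /-- Step 1: the chemical potential. -/
  chem : ∀ᵐ x ∂(volume.restrict Ω),
    μ' x = - P.lam * weakLap Ω φ' x + P.lam * P.β * φ' x
      + P.lam * (R' / P.rootE Ω φ) * P.dF φ x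
  /-- Step 1: the intermediate velocity. -/
  predict : ∀ᵐ x ∂(volume.restrict Ω),
    P.τ⁻¹ • (uhat' x - u x) + (R' / P.rootE Ω φ) • convect Ω u u x - P.ν • vecLap Ω uhat' x
      = - ((R' / P.rootE Ω φ) • (φ x • weakGrad Ω μ x + P.γ Ω p • weakGrad Ω p x))
  /-- Step 2: the scalar auxiliary variable. -/
  sav : (R' - R) / P.τ
      = 1 / (2 * P.lam * P.rootE Ω φ)
          * (P.lam * ip Ω (P.dF φ) (fun x => (φ' x - φ x) / P.τ)
            + ip Ω μ' (weakDiv Ω (fun y => φ y • u y)))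
        + 1 / (2 * P.lam * P.rootE Ω φ)
          * (ip Ω uhat' (fun x => φ x • weakGrad Ω μ x) + trilinear Ω u u uhat')
        + P.γ Ω p / (2 * P.lam * P.rootE Ω φ) * ip Ω (weakGrad Ω p) uhat'
  /-- Step 3: the correction step. -/
  correct : ∀ᵐ x ∂(volume.restrict Ω),
    P.τ⁻¹ • (u' x - uhat' x) - P.ν • vecLap Ω (fun y => u' y - uhat' y) x + weakGrad Ω p' x
      = P.γ Ω p • weakGrad Ω p x
  /-- Step 3: incompressibility. -/
  div_free : ∀ᵐ x ∂(volume.restrict Ω), weakDiv Ω u' x = 0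

/-- A solution of the first-order scheme on `0 ≤ n ≤ N`, for arbitrary data at `n = 0` with
`φ⁰, μ⁰, p⁰ ∈ H¹(Ω)` and `u⁰ ∈ H¹₀(Ω)`; the entry `uhat 0` plays no role. -/
structure IsIVSSolution {d : ℕ} (P : Params) (Ω : Set (Vec d)) (φ μ : ℕ → Vec d → ℝ)
    (uhat u : ℕ → Vec d → Vec d) (p : ℕ → Vec d → ℝ) (R : ℕ → ℝ) : Prop where
  φ_init : MemH1 Ω (φ 0)
  μ_init : MemH1 Ω (μ 0)
  u_init : VecMemH10 Ω (u 0)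
  p_init : MemH1 Ω (p 0)
  step : ∀ n < P.N, IVSStep P Ω (φ n) (μ n) (u n) (p n) (R n)
    (φ (n + 1)) (μ (n + 1)) (uhat (n + 1)) (u (n + 1)) (p (n + 1)) (R (n + 1))

end

end CHNS

namespace CHNS

/-! ### Limits of integrals of bilinear expressions -/

section Bilinear

variable {α E F G : Type*} [MeasurableSpace α] {m : Measure α}
  [NormedAddCommGroup E] [NormedSpace ℝ E] [NormedAddCommGroup F] [NormedSpace ℝ F]
  [NormedAddCommGroup G] [NormedSpace ℝ G]

/-! Each explicit nonlinear term of the scheme carries the factor ξ = R'/ρ, and the auxiliary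
equation is built so that, multiplied by 2λτR', it reproduces those same terms. Test the phase
equation with μ', the chemical potential with φ' - φ and the predictor with û' (`phase_tested`,
`chem_tested`, `predict_tested`). All nonlinear contributions, and the mixed term (φ' - φ, μ'), then
cancel exactly. What remains are expressions (a - b, a) ≥ ½(‖a‖² - ‖b‖²) and dissipation, so no
condition on τ arises.

The correction equation is tested with u', which is orthogonal to both pressure gradients because it
is divergence free and lies in H¹₀. Its viscous part costs at least ντ/2 (‖∇u'‖² - ‖∇û'‖²), which
turns the predictor dissipation ντ‖∇û'‖² into ντ/2 (‖∇û'‖² + ‖∇u'‖²). Mass is conserved because Δμ'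
and ∇·(φu) both have mean zero.

The analytic work is to justify the tests. Weak derivatives are arbitrary representatives, so they
are identified almost everywhere by `ae_eq_of_test`. Green's formula and the product rule for ∇·(φu)
pass to H¹₀ by density. Splitting an integral needs integrability: for the convective term this is
the embedding H¹₀ ⊂ L⁴. The products involving F'(φ), ∇·(φu) and φ∇μ are instead kept alone on one
side and read off from the equations. -/

theorem integrable_bilin (L : E →L[ℝ] F →L[ℝ] G) {f : α → E} {g : α → F}
    (hf : MemLp f 2 m) (hg : MemLp g 2 m) : Integrable (fun x => L (f x) (g x)) m := by
  rw [← memLp_one_iff_integrable]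
  exact hf.of_bilin (fun a b => L a b) ‖L‖₊ hg
    (L.aestronglyMeasurable_comp₂ hf.1 hg.1) (.of_forall fun x => L.le_opNorm₂ _ _)

/-- By Hölder the L¹ error is at most ‖L‖ ‖f k - f₀‖₂ ‖g‖₂. With L an inner product, a product or a
scalar multiplication, this is the passage from test functions to H¹₀. -/
theorem tendsto_integral_bilin (L : E →L[ℝ] F →L[ℝ] G) {f : ℕ → α → E} {f₀ : α → E} {g : α → F}
    (hf : ∀ k, MemLp (f k) 2 m) (hf₀ : MemLp f₀ 2 m) (hg : MemLp g 2 m)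
    (h : Tendsto (fun k => eLpNorm (fun x => f k x - f₀ x) 2 m) atTop (𝓝 0)) :
    Tendsto (fun k => ∫ x, L (f k x) (g x) ∂m) atTop (𝓝 (∫ x, L (f₀ x) (g x) ∂m)) := by
  refine tendsto_integral_of_L1' _ (integrable_bilin L hf₀ hg).1
    (.of_forall fun k => integrable_bilin L (hf k) hg) ?_
  have hbound : ∀ k, eLpNorm ((fun x => L (f k x) (g x)) - fun x => L (f₀ x) (g x)) 1 m
      ≤ ‖L‖₊ * eLpNorm (fun x => f k x - f₀ x) 2 m * eLpNorm g 2 m := by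
    intro k
    have e : ((fun x => L (f k x) (g x)) - fun x => L (f₀ x) (g x))
        = fun x => L (f k x - f₀ x) (g x) := by
      ext x; simp
    rw [e]
    exact eLpNorm_le_eLpNorm_mul_eLpNorm_of_nnnorm ((hf k).sub hf₀).1 hg.1 (fun a b => L a b) ‖L‖₊
      (.of_forall fun x => L.le_opNorm₂ _ _)
  refine tendsto_of_tendsto_of_tendsto_of_le_of_le tendsto_const_nhds ?_ (fun _ => zero_le) hbound
  have h1 := ENNReal.Tendsto.const_mul (a := (‖L‖₊ : ENNReal)) h (.inr ENNReal.coe_ne_top)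
  simpa using ENNReal.Tendsto.mul_const h1 (b := eLpNorm g 2 m) (.inr hg.2.ne)

end Bilinear

theorem integrable_inner_of_memLp {α E : Type*} [MeasurableSpace α] {m : Measure α}
    [NormedAddCommGroup E] [InnerProductSpace ℝ E] {f g : α → E} (hf : MemLp f 2 m)
    (hg : MemLp g 2 m) : Integrable (fun x => inner ℝ (f x) (g x)) m :=
  integrable_bilin (innerSL ℝ) hf hg

theorem integrable_smul_of_memLp {α E : Type*} [MeasurableSpace α] {m : Measure α}
    [NormedAddCommGroup E] [NormedSpace ℝ E] {f : α → ℝ} {g : α → E} (hf : MemLp f 2 m)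
    (hg : MemLp g 2 m) : Integrable (fun x => f x • g x) m :=
  integrable_bilin (ContinuousLinearMap.lsmul ℝ ℝ) hf hg

theorem integrable_mul_of_memLp {α : Type*} [MeasurableSpace α] {m : Measure α} {f g : α → ℝ}
    (hf : MemLp f 2 m) (hg : MemLp g 2 m) : Integrable (fun x => f x * g x) m :=
  hf.integrable_mul hg

/-! ### Gradients of smooth functions -/

variable {d : ℕ} {Ω : Set (Vec d)}

theorem gradient_mul {f g : Vec d → ℝ} {x : Vec d} (hf : DifferentiableAt ℝ f x)
    (hg : DifferentiableAt ℝ g x) :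
    gradient (fun y => f y * g y) x = f x • gradient g x + g x • gradient f x := by
  unfold gradient
  rw [fderiv_fun_mul hf hg]
  simp

theorem continuous_gradient {f : Vec d → ℝ} (hf : ContDiff ℝ ∞ f) : Continuous (gradient f) :=
  (LinearIsometryEquiv.continuous _).comp (hf.continuous_fderiv (by simp))

theorem norm_gradient (f : Vec d → ℝ) (x : Vec d) : ‖gradient f x‖ = ‖fderiv ℝ f x‖ := by
  unfold gradient
  simp

theorem tsupport_gradient_subset (f : Vec d → ℝ) : tsupport (gradient f) ⊆ tsupport f := by
  refine closure_minimal (fun x hx => ?_) isClosed_closure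
  have h : fderiv ℝ f x ≠ 0 := fun h => hx (by simp [gradient, h])
  exact tsupport_fderiv_subset ℝ (subset_tsupport _ h)

theorem hasCompactSupport_gradient {f : Vec d → ℝ} (hf : HasCompactSupport f) :
    HasCompactSupport (gradient f) :=
  hf.of_isClosed_subset isClosed_closure (tsupport_gradient_subset f)

namespace IsTest

variable {η ψ : Vec d → ℝ}

theorem memL2 (h : IsTest Ω η) : MemL2 Ω η :=
  (h.1.continuous.memLp_of_hasCompactSupport h.2.1).restrict _

theorem memL2_gradient (h : IsTest Ω η) : MemL2 Ω (gradient η) :=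
  ((continuous_gradient h.1).memLp_of_hasCompactSupport (hasCompactSupport_gradient h.2.1)).restrict _

theorem mul_left (h : IsTest Ω η) (hψ : ContDiff ℝ ∞ ψ) : IsTest Ω (fun x => ψ x * η x) :=
  ⟨hψ.mul h.1, h.2.1.mul_left, (tsupport_mul_subset_right (f := ψ) (g := η)).trans h.2.2⟩

theorem exists_bound (h : IsTest Ω η) :
    ∃ C : ℝ, (∀ x, ‖η x‖ ≤ C) ∧ ∀ x, ‖gradient η x‖ ≤ C := by
  obtain ⟨C, hC⟩ := h.1.continuous.bounded_above_of_compact_support h.2.1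
  obtain ⟨C', hC'⟩ := (continuous_gradient h.1).bounded_above_of_compact_support
    (hasCompactSupport_gradient h.2.1)
  exact ⟨max C C', fun x => (hC x).trans (le_max_left _ _),
    fun x => (hC' x).trans (le_max_right _ _)⟩

/-- Integrate η by parts against the constant 1 in each direction v. This makes 0 a weak gradient of
the constant 1. -/
theorem setIntegral_gradient (h : IsTest Ω η) : ∫ x in Ω, gradient η x = 0 := by
  have h0 : ∀ x, x ∉ Ω → gradient η x = 0 := fun x hx =>
    image_eq_zero_of_notMem_tsupport fun hx' => hx (h.2.2 (tsupport_gradient_subset η hx'))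
  rw [setIntegral_eq_integral_of_forall_compl_eq_zero h0]
  have hi : Integrable (gradient η) :=
    (continuous_gradient h.1).integrable_of_hasCompactSupport (hasCompactSupport_gradient h.2.1)
  refine ext_inner_right ℝ fun v => ?_
  rw [real_inner_comm, ← integral_inner hi, inner_zero_left]
  have c1 : ∀ x, inner ℝ v (gradient η x) = inner ℝ (gradient η x) v :=
    fun x => real_inner_comm _ _
  simp only [c1]
  have hi' := hi.inner_const (𝕜 := ℝ) v
  simp only [inner_gradient_left] at hi' ⊢
  have := integral_mul_fderiv_eq_neg_fderiv_mul_of_integrable (μ := (volume : Measure (Vec d)))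
    (f := fun _ => (1 : ℝ)) (g := η) (v := v) (by simp) (by simpa using hi')
    (by simpa using h.1.continuous.integrable_of_hasCompactSupport h.2.1) (by simp)
    (fun x _ => (h.1.differentiable (by simp)) x)
  simpa using this

end IsTest

/-! ### Uniqueness of weak derivatives -/

/-- The fundamental lemma of the calculus of variations. Since `weakGrad` and `weakDiv` are chosen
representatives, every computation with them goes through this uniqueness. -/
theorem ae_eq_of_test {F : Type*} [NormedAddCommGroup F] [NormedSpace ℝ F] [CompleteSpace F]
    (hΩ : IsOpen Ω) {f g : Vec d → F} (hf : LocallyIntegrableOn f Ω) (hg : LocallyIntegrableOn g Ω)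
    (h : ∀ η, IsTest Ω η → ∫ x in Ω, η x • f x = ∫ x in Ω, η x • g x) :
    f =ᵐ[volume.restrict Ω] g := by
  have hint : ∀ {q : Vec d → F} {η : Vec d → ℝ}, LocallyIntegrableOn q Ω → IsTest Ω η →
      Integrable (fun x => η x • q x) (volume.restrict Ω) := by
    intro q η hq hη
    have := (hq.integrableOn_compact_subset hη.2.2 hη.2.1)
    have h2 : IntegrableOn (fun x => η x • q x) (tsupport η) :=
      this.continuousOn_smul hη.1.continuous.continuousOn hη.2.1
    have h3 : Integrable (fun x => η x • q x) := by
      refine (integrableOn_iff_integrable_of_support_subset ?_).1 h2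
      exact (Function.support_smul_subset_left _ _).trans (subset_tsupport _)
    exact h3.restrict
  have key := hΩ.ae_eq_zero_of_integral_contDiff_smul_eq_zero (μ := volume) (hf.sub hg) (by
    intro η h1 h2 h3
    have hη : IsTest Ω η := ⟨h1, h2, h3⟩
    have h0 : ∀ x, x ∉ Ω → η x • (f - g) x = 0 := fun x hx => by
      rw [image_eq_zero_of_notMem_tsupport fun hx' => hx (h3 hx'), zero_smul]
    rw [← setIntegral_eq_integral_of_forall_compl_eq_zero h0]
    simp only [Pi.sub_apply, smul_sub]
    rw [integral_sub (hint hf hη) (hint hg hη), h η hη, sub_self])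
  refine (ae_restrict_iff' hΩ.measurableSet).2 ?_
  filter_upwards [key] with x hx hxΩ
  exact sub_eq_zero.1 (hx hxΩ)

theorem IsWeakGrad.ae_eq (hΩ : IsOpen Ω) {f : Vec d → ℝ} {g g' : Vec d → Vec d}
    (h : IsWeakGrad Ω f g) (h' : IsWeakGrad Ω f g') : g =ᵐ[volume.restrict Ω] g' :=
  ae_eq_of_test hΩ h.2.1 h'.2.1 fun η hη => by
    rw [← neg_inj, ← h.2.2 η hη, ← h'.2.2 η hη]

theorem IsWeakDiv.ae_eq (hΩ : IsOpen Ω) {q : Vec d → Vec d} {w w' : Vec d → ℝ}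
    (h : IsWeakDiv Ω q w) (h' : IsWeakDiv Ω q w') : w =ᵐ[volume.restrict Ω] w' :=
  ae_eq_of_test hΩ h.2.1 h'.2.1 fun η hη => by
    simp only [smul_eq_mul]
    rw [← neg_inj, ← h.2.2 η hη, ← h'.2.2 η hη]

theorem IsWeakGrad.weakGrad {f : Vec d → ℝ} {g : Vec d → Vec d} (h : IsWeakGrad Ω f g) :
    IsWeakGrad Ω f (weakGrad Ω f) := by
  have hex : ∃ g, IsWeakGrad Ω f g := ⟨g, h⟩
  rw [CHNS.weakGrad, dif_pos hex]
  exact hex.choose_spec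

theorem IsWeakDiv.weakDiv {q : Vec d → Vec d} {w : Vec d → ℝ} (h : IsWeakDiv Ω q w) :
    IsWeakDiv Ω q (weakDiv Ω q) := by
  have hex : ∃ w, IsWeakDiv Ω q w := ⟨w, h⟩
  rw [CHNS.weakDiv, dif_pos hex]
  exact hex.choose_spec

theorem IsWeakGrad.weakGrad_ae_eq (hΩ : IsOpen Ω) {f : Vec d → ℝ} {g : Vec d → Vec d}
    (h : IsWeakGrad Ω f g) : CHNS.weakGrad Ω f =ᵐ[volume.restrict Ω] g :=
  h.weakGrad.ae_eq hΩ h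

theorem IsWeakDiv.weakDiv_ae_eq (hΩ : IsOpen Ω) {q : Vec d → Vec d} {w : Vec d → ℝ}
    (h : IsWeakDiv Ω q w) : CHNS.weakDiv Ω q =ᵐ[volume.restrict Ω] w :=
  h.weakDiv.ae_eq hΩ h

/-! ### Basic properties of the function spaces -/

theorem MemL2.locallyIntegrableOn {F : Type*} [NormedAddCommGroup F] {f : Vec d → F}
    (h : MemL2 Ω f) : LocallyIntegrableOn f Ω := by
  intro x _
  refine ⟨Ω ∩ Metric.closedBall x 1, inter_mem_nhdsWithin _ (Metric.closedBall_mem_nhds x one_pos), ?_⟩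
  have hf : MemLp f 2 (volume.restrict (Ω ∩ Metric.closedBall x 1)) :=
    h.mono_measure (Measure.restrict_mono Set.inter_subset_left le_rfl)
  have : IsFiniteMeasure (volume.restrict (Ω ∩ Metric.closedBall x 1)) :=
    isFiniteMeasure_restrict.2 <| ne_top_of_le_ne_top
      (isCompact_closedBall x 1).measure_lt_top.ne (measure_mono Set.inter_subset_right)
  exact hf.integrable (by norm_num)

theorem MemH1.isWeakGrad {f : Vec d → ℝ} (h : MemH1 Ω f) : IsWeakGrad Ω f (weakGrad Ω f) :=
  h.2.choose_spec.1.weakGrad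

theorem MemH1.memL2_weakGrad (hΩ : IsOpen Ω) {f : Vec d → ℝ} (h : MemH1 Ω f) :
    MemL2 Ω (weakGrad Ω f) := by
  obtain ⟨g, hg, hg2⟩ := h.2
  exact hg2.ae_eq (hg.weakGrad_ae_eq hΩ).symm

theorem MemH10.memH1 {f : Vec d → ℝ} (h : MemH10 Ω f) : MemH1 Ω f :=
  ⟨h.1, h.2.choose, h.2.choose_spec.1, h.2.choose_spec.2.1⟩

/-- The defining sequence of test functions, with the limit of the gradients identified. -/
theorem MemH10.exists_seq (hΩ : IsOpen Ω) {f : Vec d → ℝ} (h : MemH10 Ω f) :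
    ∃ η : ℕ → Vec d → ℝ, (∀ k, IsTest Ω (η k)) ∧
      Tendsto (fun k => eLpNorm (fun x => η k x - f x) 2 (volume.restrict Ω)) atTop (𝓝 0) ∧
      Tendsto (fun k => eLpNorm (fun x => gradient (η k) x - weakGrad Ω f x) 2
        (volume.restrict Ω)) atTop (𝓝 0) := by
  obtain ⟨_, g, hg, _, η, hη, h1, h2⟩ := h
  refine ⟨η, hη, h1, h2.congr fun k => eLpNorm_congr_ae ?_⟩
  filter_upwards [hg.weakGrad_ae_eq hΩ] with x hx
  rw [hx]

theorem HasL2Lap.isWeakDiv {f : Vec d → ℝ} (h : HasL2Lap Ω f) :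
    IsWeakDiv Ω (weakGrad Ω f) (weakLap Ω f) :=
  h.choose_spec.1.weakDiv

theorem HasL2Lap.memL2_weakLap (hΩ : IsOpen Ω) {f : Vec d → ℝ} (h : HasL2Lap Ω f) :
    MemL2 Ω (weakLap Ω f) := by
  obtain ⟨w, hw, hw2⟩ := h
  exact hw2.ae_eq (hw.weakDiv_ae_eq hΩ).symm

/-! ### Green's formula and integration by parts -/

/-- Green's formula `(∇ f, ∇ v) = - (Δ f, v)` for `v ∈ H¹₀(Ω)`. -/
theorem integral_inner_weakGrad (hΩ : IsOpen Ω) {f v : Vec d → ℝ} (hf : MemH1 Ω f)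
    (hl : HasL2Lap Ω f) (hv : MemH10 Ω v) :
    ∫ x in Ω, inner ℝ (weakGrad Ω f x) (weakGrad Ω v x) = - ∫ x in Ω, weakLap Ω f x * v x := by
  obtain ⟨η, hη, h1, h2⟩ := hv.exists_seq hΩ
  have t1 := tendsto_integral_bilin (innerSL ℝ) (fun k => (hη k).memL2_gradient)
    (hv.memH1.memL2_weakGrad hΩ) (hf.memL2_weakGrad hΩ) h2
  have t2 := tendsto_integral_bilin (ContinuousLinearMap.mul ℝ ℝ) (fun k => (hη k).memL2)
    hv.1 (hl.memL2_weakLap hΩ) h1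
  simp only [ContinuousLinearMap.mul_apply'] at t2
  change Tendsto (fun k => ∫ x in Ω, inner ℝ (gradient (η k) x) (weakGrad Ω f x)) atTop
    (𝓝 (∫ x in Ω, inner ℝ (weakGrad Ω v x) (weakGrad Ω f x))) at t1
  have c1 : ∀ x, inner ℝ (weakGrad Ω f x) (weakGrad Ω v x)
      = inner ℝ (weakGrad Ω v x) (weakGrad Ω f x) := fun x => real_inner_comm _ _
  simp only [c1, mul_comm _ (v _)]
  -- For a test function the identity is the definition of the weak Laplacian; both sides converge.
  refine tendsto_nhds_unique t1 (t2.neg.congr fun k => ?_)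
  rw [← hl.isWeakDiv.2.2 _ (hη k)]
  simp only [real_inner_comm]

theorem memLp_of_bounded_smul {α E : Type*} [MeasurableSpace α] {m : Measure α}
    [NormedAddCommGroup E] [NormedSpace ℝ E] {f : α → ℝ} {g : α → E} {C : ℝ} (hf : MemLp f 2 m)
    (hg : AEStronglyMeasurable g m) (hC : ∀ x, ‖g x‖ ≤ C) : MemLp (fun x => f x • g x) 2 m :=
  hf.of_le_mul (hf.1.smul hg) (c := C) (.of_forall fun x => by
    rw [norm_smul, mul_comm]
    exact mul_le_mul_of_nonneg_right (hC x) (norm_nonneg _))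

theorem memLp_of_bounded_smul' {α E : Type*} [MeasurableSpace α] {m : Measure α}
    [NormedAddCommGroup E] [NormedSpace ℝ E] {f : α → ℝ} {g : α → E} {C : ℝ}
    (hf : AEStronglyMeasurable f m) (hg : MemLp g 2 m) (hC : ∀ x, ‖f x‖ ≤ C) :
    MemLp (fun x => f x • g x) 2 m :=
  hg.of_le_mul (hf.smul hg.1) (c := C) (.of_forall fun x => by
    rw [norm_smul]
    exact mul_le_mul_of_nonneg_right (hC x) (norm_nonneg _))

/-- Integration by parts for `φ ∈ H¹(Ω)`, `v ∈ H¹₀(Ω)` and a smooth weight `ψ`. -/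
theorem integral_smul_weakGrad (hΩ : IsOpen Ω) {φ v ψ : Vec d → ℝ} {C : ℝ} (hφ : MemH1 Ω φ)
    (hv : MemH10 Ω v) (hψ : ContDiff ℝ ∞ ψ) (hb : ∀ x, ‖ψ x‖ ≤ C)
    (hb' : ∀ x, ‖gradient ψ x‖ ≤ C) :
    ∫ x in Ω, ((φ x * ψ x) • weakGrad Ω v x + v x • φ x • gradient ψ x)
      = - ∫ x in Ω, v x • ψ x • weakGrad Ω φ x := by
  obtain ⟨η, hη, h1, h2⟩ := hv.exists_seq hΩ
  have m1 : MemL2 Ω (fun x => φ x * ψ x) :=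
    memLp_of_bounded_smul hφ.1 hψ.continuous.aestronglyMeasurable hb
  have m2 : MemL2 Ω (fun x => φ x • gradient ψ x) :=
    memLp_of_bounded_smul hφ.1 (continuous_gradient hψ).aestronglyMeasurable hb'
  have m3 : MemL2 Ω (fun x => ψ x • weakGrad Ω φ x) :=
    memLp_of_bounded_smul' hψ.continuous.aestronglyMeasurable (hφ.memL2_weakGrad hΩ) hb
  have t1 := tendsto_integral_bilin (ContinuousLinearMap.lsmul ℝ ℝ).flip
    (fun k => (hη k).memL2_gradient) (hv.memH1.memL2_weakGrad hΩ) m1 h2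
  have t2 := tendsto_integral_bilin (ContinuousLinearMap.lsmul ℝ ℝ) (fun k => (hη k).memL2)
    hv.1 m2 h1
  have t3 := tendsto_integral_bilin (ContinuousLinearMap.lsmul ℝ ℝ) (fun k => (hη k).memL2)
    hv.1 m3 h1
  simp only [ContinuousLinearMap.flip_apply, ContinuousLinearMap.lsmul_apply] at t1 t2 t3
  rw [integral_add (integrable_smul_of_memLp m1 (hv.memH1.memL2_weakGrad hΩ))
    (integrable_smul_of_memLp hv.1 m2)]
  refine tendsto_nhds_unique (t1.add t2) (t3.neg.congr fun k => ?_)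
  -- The product of ψ and a test function is again a test function, even when ψ is not compactly
  -- supported.
  have := hφ.isWeakGrad.2.2 _ ((hη k).mul_left hψ)
  rw [← integral_add (integrable_smul_of_memLp m1 (hη k).memL2_gradient)
    (integrable_smul_of_memLp (hη k).memL2 m2)]
  simp only [smul_smul, mul_comm (η k _) (ψ _)]
  rw [← this]
  congr 1; ext1 x
  rw [gradient_mul (hψ.differentiable (by simp) x) ((hη k).1.differentiable (by simp) x)]
  module

namespace IsConvexPolytopeDomain

theorem isOpen (h : IsConvexPolytopeDomain Ω) : IsOpen Ω := by
  obtain ⟨_, V, rfl⟩ := h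
  exact isOpen_interior

theorem isBounded (h : IsConvexPolytopeDomain Ω) : Bornology.IsBounded Ω := by
  obtain ⟨_, V, rfl⟩ := h
  exact ((isBounded_convexHull).2 V.finite_toSet.isBounded).subset interior_subset

theorem isFiniteMeasure (h : IsConvexPolytopeDomain Ω) :
    IsFiniteMeasure (volume.restrict Ω) :=
  isFiniteMeasure_restrict.2 h.isBounded.measure_lt_top.ne

end IsConvexPolytopeDomain

/-! ### Weak divergence of products -/

theorem VecMemH10.memL2 {u : Vec d → Vec d} (h : VecMemH10 Ω u) : MemL2 Ω u :=
  MemLp.of_eval_piLp fun i => (h i).1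

/-- The divergence `∇ φ · u + φ ∇ · u` of `φ u`, written with weak partial derivatives. -/
noncomputable def productDiv (Ω : Set (Vec d)) (φ : Vec d → ℝ) (u : Vec d → Vec d) : Vec d → ℝ :=
  fun x => ∑ i, (u x i * weakGrad Ω φ x i + φ x * weakGrad Ω (comp u i) x i)

section

variable {φ : Vec d → ℝ} {u : Vec d → Vec d}

theorem integrable_productDiv_summand (hΩ : IsOpen Ω) (hφ : MemH1 Ω φ) (hu : VecMemH10 Ω u)
    (i : Fin d) : Integrable (fun x => u x i * weakGrad Ω φ x i
      + φ x * weakGrad Ω (comp u i) x i) (volume.restrict Ω) :=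
  ((hu i).1.integrable_mul ((hφ.memL2_weakGrad hΩ).eval_piLp i)).add
    (hφ.1.integrable_mul (((hu i).memH1.memL2_weakGrad hΩ).eval_piLp i))

theorem integrable_productDiv (hΩ : IsOpen Ω) (hφ : MemH1 Ω φ) (hu : VecMemH10 Ω u) :
    Integrable (productDiv Ω φ u) (volume.restrict Ω) :=
  integrable_finsetSum _ fun i _ => integrable_productDiv_summand hΩ hφ hu i

/-- The product rule tested with a smooth weight `ψ`. -/
theorem integral_inner_smul_gradient (hΩ : IsOpen Ω) (hφ : MemH1 Ω φ) (hu : VecMemH10 Ω u)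
    {ψ : Vec d → ℝ} {C : ℝ} (hψ : ContDiff ℝ ∞ ψ) (hb : ∀ x, ‖ψ x‖ ≤ C)
    (hb' : ∀ x, ‖gradient ψ x‖ ≤ C) :
    ∫ x in Ω, inner ℝ (φ x • u x) (gradient ψ x) = - ∫ x in Ω, ψ x * productDiv Ω φ u x := by
  have m1 : MemL2 Ω (fun x => φ x * ψ x) :=
    memLp_of_bounded_smul hφ.1 hψ.continuous.aestronglyMeasurable hb
  have m2 : MemL2 Ω (fun x => φ x • gradient ψ x) :=
    memLp_of_bounded_smul hφ.1 (continuous_gradient hψ).aestronglyMeasurable hb'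
  have m3 : MemL2 Ω (fun x => ψ x • weakGrad Ω φ x) :=
    memLp_of_bounded_smul' hψ.continuous.aestronglyMeasurable (hφ.memL2_weakGrad hΩ) hb
  have key : ∀ i, ∫ x in Ω, φ x * u x i * gradient ψ x i
      = - ∫ x in Ω, ψ x * (u x i * weakGrad Ω φ x i + φ x * weakGrad Ω (comp u i) x i) := by
    intro i
    have I1 := integrable_smul_of_memLp m1 ((hu i).memH1.memL2_weakGrad hΩ)
    have I2 := integrable_smul_of_memLp (hu i).1 m2
    have I3 := integrable_smul_of_memLp (hu i).1 m3
    have h := congrArg (fun w : Vec d => w i) (integral_smul_weakGrad hΩ hφ (hu i) hψ hb hb')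
    simp only [PiLp.neg_apply] at h
    rw [integral_add I1 I2, PiLp.add_apply, eval_integral_piLp fun j => I1.eval_piLp j,
      eval_integral_piLp fun j => I2.eval_piLp j, eval_integral_piLp fun j => I3.eval_piLp j] at h
    have J1 := I1.eval_piLp i
    have J3 := I3.eval_piLp i
    simp only [PiLp.smul_apply, smul_eq_mul] at h J1 J3
    have e : ∀ x, ψ x * (u x i * weakGrad Ω φ x i + φ x * weakGrad Ω (comp u i) x i)
        = comp u i x * (ψ x * weakGrad Ω φ x i)
          + φ x * ψ x * weakGrad Ω (comp u i) x i := fun x => by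
      simp only [comp]; ring
    simp only [e]
    rw [integral_add J3 J1]
    have e2 : ∀ x, φ x * u x i * gradient ψ x i = comp u i x * (φ x * gradient ψ x i) :=
      fun x => by simp only [comp]; ring
    simp only [e2]
    linarith
  have J2 : ∀ i, Integrable (fun x => φ x * u x i * gradient ψ x i) (volume.restrict Ω) := by
    intro i
    refine ((integrable_smul_of_memLp (hu i).1 m2).eval_piLp i).congr (.of_forall fun x => ?_)
    simp only [comp, PiLp.smul_apply, smul_eq_mul]; ring
  have J : ∀ i, Integrable (fun x => ψ x * (u x i * weakGrad Ω φ x i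
      + φ x * weakGrad Ω (comp u i) x i)) (volume.restrict Ω) := fun i =>
    (integrable_productDiv_summand hΩ hφ hu i).bdd_mul hψ.continuous.aestronglyMeasurable
      (.of_forall hb)
  simp only [productDiv, Finset.mul_sum]
  rw [integral_finsetSum _ fun i _ => J i, ← Finset.sum_neg_distrib, ← Finset.sum_congr rfl
    fun i _ => key i, ← integral_finsetSum _ fun i _ => J2 i]
  congr 1; ext1 x
  simp only [PiLp.inner_apply, PiLp.smul_apply, smul_eq_mul, RCLike.inner_apply, conj_trivial]
  exact Finset.sum_congr rfl fun i _ => by ring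

/-- The weighted product rule with the weight ψ a test function. -/
theorem isWeakDiv_smul (hΩ : IsOpen Ω) (hφ : MemH1 Ω φ) (hu : VecMemH10 Ω u) :
    IsWeakDiv Ω (fun y => φ y • u y) (productDiv Ω φ u) := by
  refine ⟨IntegrableOn.locallyIntegrableOn (integrable_smul_of_memLp hφ.1 hu.memL2),
    IntegrableOn.locallyIntegrableOn (integrable_productDiv hΩ hφ hu), fun η hη => ?_⟩
  obtain ⟨C, hC, hC'⟩ := hη.exists_bound
  exact integral_inner_smul_gradient hΩ hφ hu hη.1 hC hC'

/-- The weighted product rule with ψ = 1: there is no boundary flux because u has zero trace. -/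
theorem setIntegral_productDiv (hΩ : IsOpen Ω) (hφ : MemH1 Ω φ) (hu : VecMemH10 Ω u) :
    ∫ x in Ω, productDiv Ω φ u x = 0 := by
  have h := integral_inner_smul_gradient hΩ hφ hu (ψ := fun _ => (1 : ℝ)) (C := 1)
    contDiff_const (by simp) (by simp)
  have h0 : ∀ x : Vec d, gradient (fun _ : Vec d => (1 : ℝ)) x = 0 := fun x =>
    norm_eq_zero.1 (by simp)
  simpa [h0, eq_comm] using h

theorem isWeakGrad_one [IsFiniteMeasure (volume.restrict Ω)] :
    IsWeakGrad Ω (fun _ => (1 : ℝ)) (0 : Vec d → Vec d) := by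
  refine ⟨(MemL2.locallyIntegrableOn (memLp_const 1)), MemL2.locallyIntegrableOn MemLp.zero,
    fun η hη => ?_⟩
  simpa using hη.setIntegral_gradient

theorem memH1_one [IsFiniteMeasure (volume.restrict Ω)] : MemH1 Ω (fun _ => (1 : ℝ)) :=
  ⟨memLp_const 1, 0, isWeakGrad_one, MemLp.zero⟩

/-- The product rule with φ = 1, which is in H¹ since Ω has finite measure. -/
theorem weakDiv_ae_eq_sum (hΩ : IsOpen Ω) [IsFiniteMeasure (volume.restrict Ω)]
    (hu : VecMemH10 Ω u) :
    weakDiv Ω u =ᵐ[volume.restrict Ω] fun x => ∑ i, weakGrad Ω (comp u i) x i := by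
  have h := isWeakDiv_smul hΩ (memH1_one (Ω := Ω)) hu
  simp only [one_smul] at h
  filter_upwards [h.weakDiv_ae_eq hΩ, isWeakGrad_one.weakGrad_ae_eq hΩ] with x hx h1
  rw [hx, productDiv]
  simp [h1]

/-- A divergence-free field in `H¹₀(Ω)` is orthogonal to gradients. -/
theorem ip_weakGrad_eq_zero (hΩ : IsOpen Ω) [IsFiniteMeasure (volume.restrict Ω)]
    (hφ : MemH1 Ω φ) (hu : VecMemH10 Ω u)
    (hdiv : ∀ᵐ x ∂(volume.restrict Ω), weakDiv Ω u x = 0) :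
    ∫ x in Ω, inner ℝ (weakGrad Ω φ x) (u x) = 0 := by
  -- The φ ∇·u part of the product divergence vanishes, leaving ∇φ·u.
  rw [← setIntegral_productDiv hΩ hφ hu]
  refine integral_congr_ae ?_
  filter_upwards [hdiv, weakDiv_ae_eq_sum hΩ hu] with x h0 h1
  rw [h0] at h1
  simp only [productDiv, Finset.sum_add_distrib, ← Finset.mul_sum, ← h1]
  simp [PiLp.inner_apply]

end

/-! ### The Sobolev embedding of `H¹₀(Ω)` into `L⁴(Ω)` -/

/-- Gagliardo–Nirenberg–Sobolev from W^{1,p} to L⁴ for some p ≤ 2, then Hölder from L² to L^p on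
finite measure. -/
theorem exists_eLpNorm_four_le (hd : d = 2 ∨ d = 3) (hb : Bornology.IsBounded Ω)
    [IsFiniteMeasure (volume.restrict Ω)] :
    ∃ C : ENNReal, C ≠ ⊤ ∧ ∀ η, IsTest Ω η →
      eLpNorm η 4 (volume.restrict Ω) ≤ C * eLpNorm (gradient η) 2 (volume.restrict Ω) := by
  -- For d = 3 take p = 2. For d = 2 the inequality needs p < 2, and p = 4/3 is the exponent with
  -- 1/p - 1/2 = 1/4.
  obtain ⟨p, hp1, hp2, hpd, hpq⟩ : ∃ p : NNReal, 1 ≤ p ∧ p ≤ 2 ∧ p < d ∧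
      (p : ℝ)⁻¹ - (d : ℝ)⁻¹ ≤ (4 : ℝ)⁻¹ := by
    rcases hd with rfl | rfl
    · refine ⟨4 / 3, ?_, ?_, ?_, ?_⟩
      · rw [← NNReal.coe_le_coe]; norm_num
      · rw [← NNReal.coe_le_coe]; norm_num
      · rw [← NNReal.coe_lt_coe]; norm_num
      · norm_num
    · refine ⟨2, ?_, ?_, ?_, ?_⟩
      · rw [← NNReal.coe_le_coe]; norm_num
      · exact le_rfl
      · rw [← NNReal.coe_lt_coe]; norm_num
      · norm_num
  refine ⟨eLpNormLESNormFDerivOfLeConst ℝ (volume : Measure (Vec d)) Ω p 4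
    * (volume.restrict Ω) Set.univ ^ (1 / (p : ENNReal).toReal - 1 / (2 : ENNReal).toReal), ?_,
    fun η hη => ?_⟩
  · refine ENNReal.mul_ne_top ENNReal.coe_ne_top ?_
    refine ENNReal.rpow_ne_top_of_nonneg ?_ (measure_ne_top _ _)
    have h1 : (1 : ℝ) ≤ p := by exact_mod_cast hp1
    have h2 : (p : ℝ) ≤ 2 := by exact_mod_cast hp2
    simpa using inv_anti₀ (by linarith) h2
  have hsupp : Function.support (gradient η) ⊆ Ω :=
    (subset_tsupport _).trans ((tsupport_gradient_subset η).trans hη.2.2)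
  have h1 := eLpNorm_le_eLpNorm_fderiv_of_le (volume : Measure (Vec d)) (u := η) (s := Ω)
    (hη.1.of_le (by simp)) ((subset_tsupport _).trans hη.2.2) (p := p) (q := 4) hp1
    (by simpa using hpd) (by simpa using hpq) hb
  calc eLpNorm η 4 (volume.restrict Ω) ≤ eLpNorm η 4 volume :=
        eLpNorm_mono_measure _ Measure.restrict_le_self
    _ ≤ eLpNormLESNormFDerivOfLeConst ℝ (volume : Measure (Vec d)) Ω p 4
        * eLpNorm (fderiv ℝ η) p volume := by simpa using h1
    _ = eLpNormLESNormFDerivOfLeConst ℝ (volume : Measure (Vec d)) Ω p 4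
        * eLpNorm (gradient η) p (volume.restrict Ω) := by
        rw [eLpNorm_restrict_eq_of_support_subset hsupp]
        congr 1
        exact eLpNorm_congr_norm_ae (.of_forall fun x => (norm_gradient η x).symm)
    _ ≤ _ := by
        rw [mul_assoc]
        gcongr
        rw [mul_comm]
        exact eLpNorm_le_eLpNorm_mul_rpow_measure_univ (by exact_mod_cast hp2)
          hη.memL2_gradient.1

/-- L² convergence gives convergence in measure, under which the L⁴ norm is lower semicontinuous, so
a uniform L⁴ bound on the approximants suffices. The 1 in that bound is the eventual size of ‖∇η_k -
∇v‖. -/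
theorem MemH10.memLp_four (hd : d = 2 ∨ d = 3) (hΩ : IsOpen Ω) (hb : Bornology.IsBounded Ω)
    [IsFiniteMeasure (volume.restrict Ω)] {v : Vec d → ℝ} (hv : MemH10 Ω v) :
    MemLp v 4 (volume.restrict Ω) := by
  obtain ⟨C, hC, hS⟩ := exists_eLpNorm_four_le hd hb
  obtain ⟨η, hη, h1, h2⟩ := hv.exists_seq hΩ
  refine ⟨hv.1.1, lt_of_le_of_lt (b := C * (1 + eLpNorm (weakGrad Ω v) 2 (volume.restrict Ω))) ?_
    (ENNReal.mul_lt_top hC.lt_top (ENNReal.add_lt_top.2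
      ⟨ENNReal.one_lt_top, (hv.memH1.memL2_weakGrad hΩ).2⟩))⟩
  refine eLpNorm_le_of_tendstoInMeasure (u := atTop) ?_ (tendstoInMeasure_of_tendsto_eLpNorm
    two_ne_zero (fun k => (hη k).memL2.1) hv.1.1 h1) fun k => (hη k).memL2.1
  filter_upwards [h2.eventually (gt_mem_nhds one_pos)] with k hk
  refine (hS _ (hη k)).trans ?_
  gcongr
  calc eLpNorm (gradient (η k)) 2 (volume.restrict Ω)
      = eLpNorm ((fun x => gradient (η k) x - weakGrad Ω v x) + weakGrad Ω v) 2
          (volume.restrict Ω) := by congr 1; ext1 x; simp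
    _ ≤ _ := eLpNorm_add_le ((hη k).memL2_gradient.sub (hv.memH1.memL2_weakGrad hΩ)).1
        (hv.memH1.memL2_weakGrad hΩ).1 (by norm_num)
    _ ≤ _ := by gcongr

/-- The trilinear form is given by an integrable function on `H¹₀(Ω)`. -/
theorem integrable_inner_convect (hd : d = 2 ∨ d = 3) (hΩ : IsOpen Ω)
    (hb : Bornology.IsBounded Ω) [IsFiniteMeasure (volume.restrict Ω)] {u v w : Vec d → Vec d}
    (hu : VecMemH10 Ω u) (hv : VecMemH10 Ω v) (hw : VecMemH10 Ω w) :
    Integrable (fun x => inner ℝ (convect Ω u v x) (w x)) (volume.restrict Ω) := by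
  have h442 : ENNReal.HolderTriple 4 4 2 := ⟨by
    rw [← two_mul, show (4 : ENNReal) = 2 * 2 by norm_num,
      ENNReal.mul_inv (by simp) (by simp), ← mul_assoc, ENNReal.mul_inv_cancel (by simp) (by simp),
      one_mul]⟩
  have hu4 : MemLp u 4 (volume.restrict Ω) :=
    MemLp.of_eval_piLp fun i => (hu i).memLp_four hd hΩ hb
  -- Moving the component of w onto u gives a product of two L⁴ functions, in L², paired with an L²
  -- gradient.
  have : ∀ i, Integrable (fun x => inner ℝ (comp w i x • u x) (weakGrad Ω (comp v i) x))
      (volume.restrict Ω) := fun i =>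
    integrable_inner_of_memLp (hu4.smul (r := 2) ((hw i).memLp_four hd hΩ hb))
      ((hv i).memH1.memL2_weakGrad hΩ)
  refine (integrable_finsetSum Finset.univ fun i _ => this i).congr (.of_forall fun x => ?_)
  simp only [real_inner_smul_left, comp]
  rw [PiLp.inner_apply]
  rfl

/-! ### Linearity of weak derivatives -/

theorem MemH1.isWeakGrad_sub (hΩ : IsOpen Ω) {f g : Vec d → ℝ} (hf : MemH1 Ω f)
    (hg : MemH1 Ω g) :
    IsWeakGrad Ω (fun x => f x - g x) (fun x => weakGrad Ω f x - weakGrad Ω g x) := by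
  refine ⟨MemL2.locallyIntegrableOn (hf.1.sub hg.1),
    MemL2.locallyIntegrableOn ((hf.memL2_weakGrad hΩ).sub (hg.memL2_weakGrad hΩ)), fun η hη => ?_⟩
  simp only [sub_smul, smul_sub]
  rw [integral_sub (integrable_smul_of_memLp hf.1 hη.memL2_gradient)
      (integrable_smul_of_memLp hg.1 hη.memL2_gradient),
    integral_sub (integrable_smul_of_memLp hη.memL2 (hf.memL2_weakGrad hΩ))
      (integrable_smul_of_memLp hη.memL2 (hg.memL2_weakGrad hΩ)),
    hf.isWeakGrad.2.2 η hη, hg.isWeakGrad.2.2 η hη]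
  abel

/-- Needed to split the Laplacian of u' - û' in the correction step. -/
theorem weakLap_sub_ae_eq (hΩ : IsOpen Ω) {f g : Vec d → ℝ} (hf : MemH1 Ω f) (hg : MemH1 Ω g)
    (hf' : HasL2Lap Ω f) (hg' : HasL2Lap Ω g) :
    weakLap Ω (fun x => f x - g x) =ᵐ[volume.restrict Ω]
      fun x => weakLap Ω f x - weakLap Ω g x := by
  have hgrad := (hf.isWeakGrad_sub hΩ hg).weakGrad_ae_eq hΩ
  have hfg : MemL2 Ω (fun x => weakGrad Ω f x - weakGrad Ω g x) :=
    (hf.memL2_weakGrad hΩ).sub (hg.memL2_weakGrad hΩ)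
  refine IsWeakDiv.weakDiv_ae_eq hΩ ⟨MemL2.locallyIntegrableOn (hfg.ae_eq hgrad.symm),
    MemL2.locallyIntegrableOn ((hf'.memL2_weakLap hΩ).sub (hg'.memL2_weakLap hΩ)), fun η hη => ?_⟩
  have e : ∫ x in Ω, inner ℝ (weakGrad Ω (fun x => f x - g x) x) (gradient η x)
      = ∫ x in Ω, (inner ℝ (weakGrad Ω f x) (gradient η x)
        - inner ℝ (weakGrad Ω g x) (gradient η x)) := by
    refine integral_congr_ae ?_
    filter_upwards [hgrad] with x hx
    rw [hx, inner_sub_left]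
  rw [e, integral_sub (integrable_inner_of_memLp (hf.memL2_weakGrad hΩ) hη.memL2_gradient)
      (integrable_inner_of_memLp (hg.memL2_weakGrad hΩ) hη.memL2_gradient)]
  simp only [mul_sub]
  rw [integral_sub (integrable_mul_of_memLp hη.memL2 (hf'.memL2_weakLap hΩ))
      (integrable_mul_of_memLp hη.memL2 (hg'.memL2_weakLap hΩ)),
    hf'.isWeakDiv.2.2 η hη, hg'.isWeakDiv.2.2 η hη]
  ring

/-! ### Vector Laplacians -/

theorem VecHasL2Lap.memL2_vecLap (hΩ : IsOpen Ω) {v : Vec d → Vec d} (h : VecHasL2Lap Ω v) :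
    MemL2 Ω (vecLap Ω v) :=
  MemLp.of_eval_piLp fun i => (h i).memL2_weakLap hΩ

theorem integral_inner_vecLap (hΩ : IsOpen Ω) {v w : Vec d → Vec d} (hv : VecMemH10 Ω v)
    (hl : VecHasL2Lap Ω v) (hw : VecMemH10 Ω w) :
    ∫ x in Ω, inner ℝ (vecLap Ω v x) (w x)
      = - ∑ i, ∫ x in Ω, inner ℝ (weakGrad Ω (comp v i) x) (weakGrad Ω (comp w i) x) := by
  simp only [integral_inner_weakGrad hΩ (hv _).memH1 (hl _) (hw _), Finset.sum_neg_distrib,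
    neg_neg]
  rw [← integral_finsetSum _ fun i _ =>
    integrable_mul_of_memLp ((hl i).memL2_weakLap hΩ) (hw i).1]
  congr 1; ext1 x
  rw [PiLp.inner_apply]
  exact Finset.sum_congr rfl fun i _ => by
    simp only [vecLap, comp, RCLike.inner_apply, conj_trivial]; ring

theorem vecLap_sub_ae_eq (hΩ : IsOpen Ω) {v w : Vec d → Vec d} (hv : VecMemH10 Ω v)
    (hw : VecMemH10 Ω w) (hv' : VecHasL2Lap Ω v) (hw' : VecHasL2Lap Ω w) :
    vecLap Ω (fun y => v y - w y) =ᵐ[volume.restrict Ω]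
      fun x => vecLap Ω v x - vecLap Ω w x := by
  have h := ae_all_iff.2 fun i =>
    weakLap_sub_ae_eq hΩ (hv i).memH1 (hw i).memH1 (hv' i) (hw' i)
  filter_upwards [h] with x hx
  ext i
  exact hx i

/-! ### Differences in inner products -/

/-- Since (a - b, a) = ½(|a|² - |b|² + |a - b|²), it suffices to drop the last square. -/
theorem half_sqNorm_sub_le {F : Type*} [NormedAddCommGroup F] [InnerProductSpace ℝ F]
    {f g : Vec d → F} (hf : MemL2 Ω f) (hg : MemL2 Ω g) :
    1 / 2 * (sqNorm Ω f - sqNorm Ω g) ≤ ∫ x in Ω, inner ℝ (f x - g x) (f x) := by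
  have h1 := (memLp_two_iff_integrable_sq_norm hf.1).1 hf
  have h2 := (memLp_two_iff_integrable_sq_norm hg.1).1 hg
  unfold sqNorm
  rw [← integral_sub h1 h2, ← integral_const_mul]
  refine integral_mono ((h1.sub h2).const_mul _) (integrable_inner_of_memLp (hf.sub hg) hf)
    fun x => ?_
  have h := norm_sub_sq_real (f x) (g x)
  have h' := sq_nonneg ‖f x - g x‖
  simp only [inner_sub_left, real_inner_self_eq_norm_sq, real_inner_comm (f x) (g x)] at h ⊢
  linarith

theorem sqNorm_eq_integral_inner {F : Type*} [NormedAddCommGroup F] [InnerProductSpace ℝ F]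
    (f : Vec d → F) : sqNorm Ω f = ∫ x in Ω, inner ℝ (f x) (f x) := by
  simp only [sqNorm, real_inner_self_eq_norm_sq]

/-! ### The discrete identities -/

theorem Params.τ_pos (P : Params) : 0 < P.τ :=
  div_pos P.T_pos (Nat.cast_pos.2 P.N_pos)

namespace IVSStep

variable {P : Params} {φ μ : Vec d → ℝ} {u : Vec d → Vec d} {p : Vec d → ℝ} {R : ℝ}
  {φ' μ' : Vec d → ℝ} {uhat' u' : Vec d → Vec d} {p' : Vec d → ℝ} {R' : ℝ}

/-- Integrate the phase equation: Δμ' has mean zero by testing the Neumann condition with 1, and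
∇·(φu) because u vanishes on the boundary. -/
theorem mass (hΩ : IsOpen Ω) [IsFiniteMeasure (volume.restrict Ω)]
    (h : IVSStep P Ω φ μ u p R φ' μ' uhat' u' p' R') (hφ : MemH1 Ω φ) (hu : VecMemH10 Ω u) :
    ∫ x in Ω, φ' x = ∫ x in Ω, φ x := by
  have hdiv := (isWeakDiv_smul hΩ hφ hu).weakDiv_ae_eq hΩ
  have i1 : Integrable φ (volume.restrict Ω) := hφ.1.integrable (by norm_num)
  have i2 : Integrable φ' (volume.restrict Ω) := h.φ_H1.1.integrable (by norm_num)
  have i3 : Integrable (weakLap Ω μ') (volume.restrict Ω) :=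
    (h.μ_lap.memL2_weakLap hΩ).integrable (by norm_num)
  have i4 := integrable_productDiv hΩ hφ hu
  have hlap : ∫ x in Ω, weakLap Ω μ' x = 0 := by
    have h0 : ∫ x in Ω, inner ℝ (weakGrad Ω μ' x) (weakGrad Ω (fun _ => (1 : ℝ)) x) = 0 := by
      refine integral_eq_zero_of_ae ?_
      filter_upwards [isWeakGrad_one.weakGrad_ae_eq hΩ] with x hx
      simp [hx]
    have := h.μ_bdry _ memH1_one
    rw [h0] at this
    simpa using this
  have key : ∫ x in Ω, (φ' x - φ x) = ∫ x in Ω, (P.τ * P.M * weakLap Ω μ' x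
      - P.τ * (R' / P.rootE Ω φ) * productDiv Ω φ u x) := by
    refine integral_congr_ae ?_
    filter_upwards [h.phase, hdiv] with x hx h1
    have hτ := P.τ_pos.ne'
    rw [h1] at hx
    have e : (φ' x - φ x) / P.τ
        = P.M * weakLap Ω μ' x - R' / P.rootE Ω φ * productDiv Ω φ u x := by linarith
    rw [div_eq_iff hτ] at e
    linear_combination e
  rw [integral_sub i2 i1, integral_sub (i3.const_mul _) (i4.const_mul _), integral_const_mul,
    integral_const_mul, hlap, setIntegral_productDiv hΩ hφ hu] at key
  linarith

/-- The phase equation times τμ'. The divergence term stays alone on the left, so its integrability,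
not evident from ∇·(φu) ∈ L¹, is never needed. -/
theorem phase_tested (hΩ : IsOpen Ω) (h : IVSStep P Ω φ μ u p R φ' μ' uhat' u' p' R')
    (hφ : MemH1 Ω φ) :
    P.τ * (R' / P.rootE Ω φ) * ip Ω μ' (weakDiv Ω (fun y => φ y • u y))
      = - (P.M * P.τ * sqNorm Ω (weakGrad Ω μ')) - ∫ x in Ω, (φ' x - φ x) * μ' x := by
  have i1 : Integrable (fun x => (φ' x - φ x) * μ' x) (volume.restrict Ω) :=
    (h.φ_H1.1.sub hφ.1).integrable_mul h.μ_H1.1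
  have i2 : Integrable (fun x => weakLap Ω μ' x * μ' x) (volume.restrict Ω) :=
    (h.μ_lap.memL2_weakLap hΩ).integrable_mul h.μ_H1.1
  have hb := h.μ_bdry μ' h.μ_H1
  rw [← sqNorm_eq_integral_inner] at hb
  have key : ∫ x in Ω, P.τ * (R' / P.rootE Ω φ)
        * inner ℝ (μ' x) (weakDiv Ω (fun y => φ y • u y) x)
      = ∫ x in Ω, (P.M * P.τ * (weakLap Ω μ' x * μ' x) - (φ' x - φ x) * μ' x) := by
    refine integral_congr_ae ?_
    filter_upwards [h.phase] with x hx
    have hτ := P.τ_pos.ne'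
    simp only [RCLike.inner_apply, conj_trivial]
    have e : (R' / P.rootE Ω φ) * weakDiv Ω (fun y => φ y • u y) x
        = P.M * weakLap Ω μ' x - (φ' x - φ x) / P.τ := by linarith
    calc _ = P.τ * ((R' / P.rootE Ω φ) * weakDiv Ω (fun y => φ y • u y) x) * μ' x := by ring
      _ = _ := by rw [e]; field_simp
  rw [integral_const_mul, integral_sub (i2.const_mul _) i1, integral_const_mul] at key
  rw [ip, key]
  linear_combination P.M * P.τ * hb

/-- The chemical potential equation times φ' - φ. Isolating the F'(φ) term avoids any growth
estimate for it. -/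
theorem chem_tested (hΩ : IsOpen Ω) (h : IVSStep P Ω φ μ u p R φ' μ' uhat' u' p' R')
    (hφ : MemH1 Ω φ) :
    P.τ * P.lam * (R' / P.rootE Ω φ) * ip Ω (P.dF φ) (fun x => (φ' x - φ x) / P.τ)
      = (∫ x in Ω, (φ' x - φ x) * μ' x)
        - P.lam * (∫ x in Ω, inner ℝ (weakGrad Ω φ' x - weakGrad Ω φ x) (weakGrad Ω φ' x))
        - P.lam * P.β * ∫ x in Ω, inner ℝ (φ' x - φ x) (φ' x) := by
  have i1 : Integrable (fun x => (φ' x - φ x) * μ' x) (volume.restrict Ω) :=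
    (h.φ_H1.1.sub hφ.1).integrable_mul h.μ_H1.1
  have i2 : Integrable (fun x => weakLap Ω φ' x * φ' x) (volume.restrict Ω) :=
    (h.φ_lap.memL2_weakLap hΩ).integrable_mul h.φ_H1.1
  have i3 : Integrable (fun x => weakLap Ω φ' x * φ x) (volume.restrict Ω) :=
    (h.φ_lap.memL2_weakLap hΩ).integrable_mul hφ.1
  have i4 : Integrable (fun x => inner ℝ (φ' x - φ x) (φ' x)) (volume.restrict Ω) :=
    integrable_inner_of_memLp (h.φ_H1.1.sub hφ.1) h.φ_H1.1
  have hb := h.φ_bdry φ' h.φ_H1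
  -- Only φ' carries the Neumann condition; φ enters as an H¹ test function, so φ⁰ needs no boundary
  -- condition.
  have hb' := h.φ_bdry φ hφ
  have hg : ∫ x in Ω, inner ℝ (weakGrad Ω φ' x - weakGrad Ω φ x) (weakGrad Ω φ' x)
      = (∫ x in Ω, inner ℝ (weakGrad Ω φ' x) (weakGrad Ω φ' x))
        - ∫ x in Ω, inner ℝ (weakGrad Ω φ' x) (weakGrad Ω φ x) := by
    have m1 := h.φ_H1.memL2_weakGrad hΩ
    rw [← integral_sub (integrable_inner_of_memLp m1 m1)
      (integrable_inner_of_memLp m1 (hφ.memL2_weakGrad hΩ))]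
    congr 1; ext1 x
    rw [inner_sub_left, real_inner_comm (weakGrad Ω φ' x) (weakGrad Ω φ x)]
  have key : ∫ x in Ω, P.τ * P.lam * (R' / P.rootE Ω φ)
        * inner ℝ (P.dF φ x) ((φ' x - φ x) / P.τ)
      = ∫ x in Ω, ((φ' x - φ x) * μ' x
        + P.lam * (weakLap Ω φ' x * φ' x - weakLap Ω φ' x * φ x)
        - P.lam * P.β * inner ℝ (φ' x - φ x) (φ' x)) := by
    refine integral_congr_ae ?_
    filter_upwards [h.chem] with x hx
    have hτ := P.τ_pos.ne'
    simp only [RCLike.inner_apply, conj_trivial]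
    rw [hx]
    field_simp
    ring
  have i5 := (i2.sub i3).const_mul P.lam
  simp only [Pi.sub_apply] at i5
  have i6 := i1.add i5
  simp only [Pi.add_def] at i6
  rw [integral_const_mul, integral_sub i6 (i4.const_mul _), integral_add i1 i5,
    integral_const_mul, integral_const_mul, integral_sub i2 i3] at key
  rw [ip, key, hg]
  linear_combination P.lam * (hb - hb')

/-- The predictor times τû'. The φ∇μ term is expressed through the others, whose integrability
follows from L² bounds and the L⁴ embedding. -/
theorem predict_tested (hd : d = 2 ∨ d = 3) (hΩ : IsOpen Ω) (hbd : Bornology.IsBounded Ω)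
    [IsFiniteMeasure (volume.restrict Ω)] (h : IVSStep P Ω φ μ u p R φ' μ' uhat' u' p' R')
    (hu : VecMemH10 Ω u) (hp : MemH1 Ω p) :
    P.τ * (R' / P.rootE Ω φ) * (ip Ω uhat' (fun x => φ x • weakGrad Ω μ x)
        + trilinear Ω u u uhat' + P.γ Ω p * ip Ω (weakGrad Ω p) uhat')
      = - (∫ x in Ω, inner ℝ (uhat' x - u x) (uhat' x)) - P.ν * P.τ * vecGradSqNorm Ω uhat' := by
  have hm := h.uhat_H10.memL2
  have i1 : Integrable (fun x => inner ℝ (uhat' x - u x) (uhat' x)) (volume.restrict Ω) :=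
    integrable_inner_of_memLp (hm.sub hu.memL2) hm
  have i2 := integrable_inner_convect hd hΩ hbd hu hu h.uhat_H10
  have i3 := integrable_inner_of_memLp (h.uhat_lap.memL2_vecLap hΩ) hm
  have i4 := integrable_inner_of_memLp (hp.memL2_weakGrad hΩ) hm
  have hl := integral_inner_vecLap hΩ h.uhat_H10 h.uhat_lap h.uhat_H10
  simp only [← sqNorm_eq_integral_inner] at hl
  have key : ∫ x in Ω, P.τ * (R' / P.rootE Ω φ) * inner ℝ (uhat' x) (φ x • weakGrad Ω μ x)
      = ∫ x in Ω, (P.ν * P.τ * inner ℝ (vecLap Ω uhat' x) (uhat' x)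
        - inner ℝ (uhat' x - u x) (uhat' x)
        - P.τ * (R' / P.rootE Ω φ) * inner ℝ (convect Ω u u x) (uhat' x)
        - P.τ * (R' / P.rootE Ω φ) * P.γ Ω p * inner ℝ (weakGrad Ω p x) (uhat' x)) := by
    refine integral_congr_ae ?_
    filter_upwards [h.predict] with x hx
    have hτ := P.τ_pos.ne'
    have hx' := congrArg (fun w => inner ℝ w (uhat' x)) hx
    simp only [inner_sub_left (P.τ⁻¹ • (uhat' x - u x) + _), inner_add_left, inner_neg_left,
      real_inner_smul_left] at hx'
    rw [real_inner_comm, real_inner_smul_left]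
    have e : P.τ * (P.τ⁻¹ * inner ℝ (uhat' x - u x) (uhat' x))
        = inner ℝ (uhat' x - u x) (uhat' x) := by field_simp
    linear_combination P.τ * hx' - e
  rw [integral_const_mul, integral_sub _ (i4.const_mul _), integral_sub _ (i2.const_mul _),
    integral_sub (i3.const_mul _) i1, integral_const_mul, integral_const_mul, integral_const_mul,
    hl] at key
  · rw [trilinear, ip, ip, ip, vecGradSqNorm]
    linear_combination key
  · exact (i3.const_mul _).sub i1
  · exact ((i3.const_mul _).sub i1).sub (i2.const_mul _)

/-- The correction equation times τu'; both the old and the new pressure gradient drop out by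
orthogonality. -/
theorem correct_tested (hΩ : IsOpen Ω) [IsFiniteMeasure (volume.restrict Ω)]
    (h : IVSStep P Ω φ μ u p R φ' μ' uhat' u' p' R') (hp : MemH1 Ω p) :
    (∫ x in Ω, inner ℝ (u' x - uhat' x) (u' x))
      + P.ν * P.τ * ∑ i, (∫ x in Ω, inner ℝ
        (weakGrad Ω (comp u' i) x - weakGrad Ω (comp uhat' i) x) (weakGrad Ω (comp u' i) x))
      = 0 := by
  have hm := h.u_H10.memL2
  have i1 : Integrable (fun x => inner ℝ (u' x - uhat' x) (u' x)) (volume.restrict Ω) :=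
    integrable_inner_of_memLp (hm.sub h.uhat_H10.memL2) hm
  have i2 := integrable_inner_of_memLp (h.u_lap.memL2_vecLap hΩ) hm
  have i3 := integrable_inner_of_memLp (h.uhat_lap.memL2_vecLap hΩ) hm
  have i4 := integrable_inner_of_memLp (hp.memL2_weakGrad hΩ) hm
  have i5 := integrable_inner_of_memLp (h.p_H1.memL2_weakGrad hΩ) hm
  have hl := integral_inner_vecLap hΩ h.u_H10 h.u_lap h.u_H10
  have hl' := integral_inner_vecLap hΩ h.uhat_H10 h.uhat_lap h.u_H10
  have z4 := ip_weakGrad_eq_zero hΩ hp h.u_H10 h.div_free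
  have z5 := ip_weakGrad_eq_zero hΩ h.p_H1 h.u_H10 h.div_free
  have key : ∫ x in Ω, inner ℝ (u' x - uhat' x) (u' x)
      = ∫ x in Ω, (P.ν * P.τ * (inner ℝ (vecLap Ω u' x) (u' x) - inner ℝ (vecLap Ω uhat' x) (u' x))
        + (P.τ * P.γ Ω p * inner ℝ (weakGrad Ω p x) (u' x)
          - P.τ * inner ℝ (weakGrad Ω p' x) (u' x))) := by
    refine integral_congr_ae ?_
    filter_upwards [h.correct, vecLap_sub_ae_eq hΩ h.u_H10 h.uhat_H10 h.u_lap h.uhat_lap]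
      with x hx hv
    have hτ := P.τ_pos.ne'
    rw [hv] at hx
    have hx' := congrArg (fun w => inner ℝ w (u' x)) hx
    rw [← inner_sub_left (vecLap Ω u' x)]
    simp only [inner_sub_left (P.τ⁻¹ • (u' x - uhat' x)), inner_add_left,
      real_inner_smul_left] at hx'
    have e : P.τ * (P.τ⁻¹ * inner ℝ (u' x - uhat' x) (u' x))
        = inner ℝ (u' x - uhat' x) (u' x) := by field_simp
    linear_combination P.τ * hx' - e
  have i23 := (i2.sub i3).const_mul (P.ν * P.τ)
  simp only [Pi.sub_apply] at i23
  have i45 := (i4.const_mul (P.τ * P.γ Ω p)).sub (i5.const_mul P.τ)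
  simp only [Pi.sub_def] at i45
  rw [integral_add i23 i45,
    integral_sub (i4.const_mul _) (i5.const_mul _), integral_const_mul, integral_const_mul,
    integral_const_mul, integral_sub i2 i3, z4, z5, hl, hl'] at key
  have hg : ∀ i, ∫ x in Ω, inner ℝ
        (weakGrad Ω (comp u' i) x - weakGrad Ω (comp uhat' i) x) (weakGrad Ω (comp u' i) x)
      = (∫ x in Ω, inner ℝ (weakGrad Ω (comp u' i) x) (weakGrad Ω (comp u' i) x))
        - ∫ x in Ω, inner ℝ (weakGrad Ω (comp uhat' i) x) (weakGrad Ω (comp u' i) x) := by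
    intro i
    have m1 := (h.u_H10 i).memH1.memL2_weakGrad hΩ
    simp only [inner_sub_left]
    exact integral_sub (integrable_inner_of_memLp m1 m1)
      (integrable_inner_of_memLp ((h.uhat_H10 i).memH1.memL2_weakGrad hΩ) m1)
  simp only [hg, Finset.sum_sub_distrib]
  linear_combination key

theorem energy_le (hd : d = 2 ∨ d = 3) (hΩ : IsOpen Ω) (hbd : Bornology.IsBounded Ω)
    [IsFiniteMeasure (volume.restrict Ω)] (h : IVSStep P Ω φ μ u p R φ' μ' uhat' u' p' R')
    (hφ : MemH1 Ω φ) (hu : VecMemH10 Ω u) (hp : MemH1 Ω p) (hE : 0 < P.E₁ Ω φ + P.δ₀) :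
    P.energy Ω φ' u' R' - P.energy Ω φ u R
      ≤ - P.M * P.τ * sqNorm Ω (weakGrad Ω μ')
        - P.ν * P.τ / 2 * (vecGradSqNorm Ω uhat' + vecGradSqNorm Ω u') := by
  have hρ : P.rootE Ω φ ≠ 0 := (Real.sqrt_pos.2 hE).ne'
  have hτ := P.τ_pos
  have hlam := P.lam_pos
  have hA := h.phase_tested hΩ hφ
  have hB := h.chem_tested hΩ hφ
  have hC := h.predict_tested hd hΩ hbd hu hp
  have hD := h.correct_tested hΩ hp
  -- The auxiliary equation times 2λτR'; its right side is the sum of the left sides of the three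
  -- tested equations.
  have hS : 2 * P.lam * R' * (R' - R) = P.τ * P.lam * (R' / P.rootE Ω φ)
        * ip Ω (P.dF φ) (fun x => (φ' x - φ x) / P.τ)
      + P.τ * (R' / P.rootE Ω φ) * ip Ω μ' (weakDiv Ω (fun y => φ y • u y))
      + P.τ * (R' / P.rootE Ω φ) * (ip Ω uhat' (fun x => φ x • weakGrad Ω μ x)
        + trilinear Ω u u uhat' + P.γ Ω p * ip Ω (weakGrad Ω p) uhat') := by
    have e : R' - R = P.τ * ((R' - R) / P.τ) := by field_simp
    rw [e, h.sav]
    field_simp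
    ring
  rw [hA, hB, hC] at hS
  have q1 := half_sqNorm_sub_le h.φ_H1.1 hφ.1
  have q2 := half_sqNorm_sub_le (h.φ_H1.memL2_weakGrad hΩ) (hφ.memL2_weakGrad hΩ)
  have q3 := half_sqNorm_sub_le h.uhat_H10.memL2 hu.memL2
  have q4 := half_sqNorm_sub_le h.u_H10.memL2 h.uhat_H10.memL2
  have q5 : 1 / 2 * (vecGradSqNorm Ω u' - vecGradSqNorm Ω uhat')
      ≤ ∑ i, (∫ x in Ω, inner ℝ (weakGrad Ω (comp u' i) x - weakGrad Ω (comp uhat' i) x)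
        (weakGrad Ω (comp u' i) x)) := by
    rw [vecGradSqNorm, vecGradSqNorm, ← Finset.sum_sub_distrib, Finset.mul_sum]
    exact Finset.sum_le_sum fun i _ => half_sqNorm_sub_le
      ((h.u_H10 i).memH1.memL2_weakGrad hΩ) ((h.uhat_H10 i).memH1.memL2_weakGrad hΩ)
  have r1 := mul_le_mul_of_nonneg_left q1 (mul_pos hlam P.β_pos).le
  have r2 := mul_le_mul_of_nonneg_left q2 hlam.le
  have r5 := mul_le_mul_of_nonneg_left q5 (mul_pos P.ν_pos hτ).le
  -- From 2R'(R' - R) = R'² - R² + (R' - R)².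
  have r6 := mul_nonneg hlam.le (sq_nonneg (R' - R))
  simp only [Params.energy, sq_abs]
  nlinarith only [hS, hD, r1, r2, q3, q4, r5, r6]

end IVSStep

end CHNS

theorem mainTheorem4 (d : ℕ) (hd : d = 2 ∨ d = 3) (Ω : Set (CHNS.Vec d))
    (hΩ : CHNS.IsConvexPolytopeDomain Ω) (P : CHNS.Params)
    (φ μ : ℕ → CHNS.Vec d → ℝ) (uhat u : ℕ → CHNS.Vec d → CHNS.Vec d)
    (p : ℕ → CHNS.Vec d → ℝ) (R : ℕ → ℝ)
    (hE : ∀ n < P.N, 0 < P.E₁ Ω (φ n) + P.δ₀)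
    (hsol : CHNS.IsIVSSolution P Ω φ μ uhat u p R) :
    (∀ n < P.N, ∫ x in Ω, φ (n + 1) x = ∫ x in Ω, φ n x) ∧
    (∀ n < P.N,
      P.energy Ω (φ (n + 1)) (u (n + 1)) (R (n + 1)) - P.energy Ω (φ n) (u n) (R n)
        ≤ - P.M * P.τ * CHNS.sqNorm Ω (CHNS.weakGrad Ω (μ (n + 1)))
          - P.ν * P.τ / 2
            * (CHNS.vecGradSqNorm Ω (uhat (n + 1)) + CHNS.vecGradSqNorm Ω (u (n + 1)))) := by
  have := hΩ.isFiniteMeasure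
  -- Regularity at time n comes from the initial data or from the step ending at n.
  have hreg : ∀ n < P.N, CHNS.MemH1 Ω (φ n) ∧ CHNS.VecMemH10 Ω (u n) ∧ CHNS.MemH1 Ω (p n) := by
    rintro (_ | n) hn
    · exact ⟨hsol.φ_init, hsol.u_init, hsol.p_init⟩
    · have h := hsol.step n (Nat.lt_of_succ_lt hn)
      exact ⟨h.φ_H1, h.u_H10, h.p_H1⟩
  refine ⟨fun n hn => ?_, fun n hn => ?_⟩ <;> obtain ⟨h1, h2, h3⟩ := hreg n hn
  · exact (hsol.step n hn).mass hΩ.isOpen h1 h2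
  · exact (hsol.step n hn).energy_le hd hΩ.isOpen hΩ.isBounded h1 h2 h3 (hE n hn)
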